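/- Let $\Omega=(\mathbb R/2\pi\mathbb Z)^2$ be the doubly periodic cell $[0,2\pi]^2$, let $f(s)=s^3-s$ and $W(s)=\tfrac14(s^2-1)^2$ (so $f=W'$), and for $\epsilon>0$ let $$\mathcal E(u)=\int_\Omega\Big(\tfrac12|\nabla u|^2+\tfrac1{\epsilon^2}W(u)\Big).$$ Let $\epsilon>0$, $k>0$, and let $u_n\in H^2(\Omega)$ take values in $[-1,1]$ (almost everywhere). Consider the Backward Euler step of the Allen–Cahn equation, $$u-k\,\Delta u+\frac{k}{\epsilon^2}f(u)=u_n \quad\text{a.e. in }\Omega. \qquad (\mathrm{BE})$$ Then there exists $u\in H^2(\Omega)$ with values in $[-1,1]$ (almost everywhere) that solves (BE). Moreover, with $f_\infty:=\max\{|f'(s)| : s\in[-1,1]\}$, if $k\le 2\epsilon^2/f_\infty$, then $u$ is the unique solution of (BE) in $H^2(\Omega)$ (up to equality almost everywhere), and it satisfies $\mathcal E(u)\le\mathcal E(u_n)$. -/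

import Mathlib

open MeasureTheory

namespace AllenCahn

noncomputable section

/-- The period `2π` is positive (needed for the measure on `ℝ / 2πℤ`). -/
instance two_pi_pos_fact : Fact (0 < 2 * Real.pi) := ⟨Real.two_pi_pos⟩

/-- The doubly periodic cell `[0, 2π]²`, as the flat torus `(ℝ / 2πℤ)²`. It carries the product
Lebesgue measure `volume`, of total mass `(2π)²`. -/
abbrev Torus : Type := Fin 2 → AddCircle (2 * Real.pi)

/-- The covering map `ℝ² → (ℝ / 2πℤ)²`. -/
def Torus.proj (x : Fin 2 → ℝ) : Torus := fun i => (x i : AddCircle (2 * Real.pi))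

/-- A `C^∞` function on the torus, i.e. one whose doubly periodic lift to `ℝ²` is `C^∞`. -/
def IsSmooth (φ : Torus → ℝ) : Prop :=
  ContDiff ℝ (⊤ : ℕ∞) (fun x : Fin 2 → ℝ => φ (Torus.proj x))

/-- The classical partial derivative `∂φ/∂xᵢ` on the torus. -/
def partialDeriv (i : Fin 2) (φ : Torus → ℝ) (p : Torus) : ℝ :=
  deriv (fun s : ℝ => φ (p + Torus.proj (Pi.single i s))) 0

/-- `g` is a weak `i`-th partial derivative of `u` on the torus: `∫ u ∂ᵢφ = - ∫ g φ` for all smooth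
doubly periodic test functions `φ`. (Used for `u, g ∈ L²`.) -/
def IsWeakPartial (i : Fin 2) (u g : Torus → ℝ) : Prop :=
  ∀ φ : Torus → ℝ, IsSmooth φ →
    ∫ p, u p * partialDeriv i φ p = - ∫ p, g p * φ p

/-- `u` has a weak `i`-th partial derivative in `L²`. -/
def HasWeakPartialL2 (i : Fin 2) (u : Torus → ℝ) : Prop :=
  ∃ g : Torus → ℝ, MemLp g 2 volume ∧ IsWeakPartial i u g

open Classical in
/-- The weak partial derivative `∂ᵢu ∈ L²`, where it exists (it is determined almost everywhere);
`0` otherwise. -/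
def weakPartial (i : Fin 2) (u : Torus → ℝ) : Torus → ℝ :=
  if h : HasWeakPartialL2 i u then h.choose else 0

/-- The Sobolev space `H¹` of the torus. -/
def MemH1 (u : Torus → ℝ) : Prop :=
  MemLp u 2 volume ∧ ∀ i, HasWeakPartialL2 i u

/-- The Sobolev space `H²` of the torus: `u` and all its weak first partial derivatives are in
`H¹`. -/
def MemH2 (u : Torus → ℝ) : Prop :=
  MemH1 u ∧ ∀ i, MemH1 (weakPartial i u)

/-- The Laplacian `Δu = ∂₁∂₁u + ∂₂∂₂u` of an `H²` function, through weak derivatives. -/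
def laplacian (u : Torus → ℝ) (p : Torus) : ℝ :=
  ∑ i, weakPartial i (weakPartial i u) p

/-- The reaction term `f(u) = u³ - u`. -/
def f (s : ℝ) : ℝ := s ^ 3 - s

/-- The double-well potential `W(u) = (u² - 1)² / 4`, with `W' = f`. -/
def W (s : ℝ) : ℝ := (s ^ 2 - 1) ^ 2 / 4

/-- `f_∞ = max { |f'(s)| : s ∈ [-1, 1] }`. -/
def fInf : ℝ := sSup ((fun s => |deriv f s|) '' Set.Icc (-1) 1)

/-- The Allen-Cahn energy `ℰ(u) = ∫ (|∇u|² / 2 + W(u) / ε²)`. -/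
def energy (ε : ℝ) (u : Torus → ℝ) : ℝ :=
  ∫ p, ((∑ i, weakPartial i u p ^ 2) / 2 + W (u p) / ε ^ 2)

/-- `u` solves the Backward Euler step `u - k Δu + (k / ε²) f(u) = uₙ` (almost everywhere). -/
def SolvesBE (ε k : ℝ) (un u : Torus → ℝ) : Prop :=
  ∀ᵐ p, u p - k * laplacian u p + k / ε ^ 2 * f (u p) = un p

/-- `u` takes values in `[-1, 1]` (as an element of `L²`, i.e. almost everywhere). -/
def ValuesInUnit (u : Torus → ℝ) : Prop :=
  ∀ᵐ p, u p ∈ Set.Icc (-1 : ℝ) 1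

end

end AllenCahn

namespace AllenCahn
noncomputable section

open Filter Topology

/-! ### The covering map and smooth functions -/

/-! Existence is a monotone iteration. Adding `2u/ε²` to (BE) divided by `k` gives `(l - Δ)u = uₙ/k
+ (3u - u³)/ε²` with `l = 1/k + 2/ε²`. On `[-1,1]` the right side is nondecreasing in `u` and lies
between `-l` and `l`, so by comparison the iterates started from `1` decrease and stay in `[-1,1]`.
Dominated convergence passes the very weak equation to the pointwise limit (`exists_solvesBE`);
since very weak `L²` solutions of the linear problem are unique, the limit is its `H²` solution.

The linear theory rests on trigonometric polynomials, where `l - Δ` is an invertible Fourier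
multiplier. An exact norm identity (`norm_sq_trigL2_helm`) bounds all derivatives up to order two,
so density yields `H²` solutions (`exists_memH2_approx`). The classical maximum principle for
polynomials becomes, by duality, the comparison principle `IsVeryWeak.ae_le`.

Since `f_∞ = 2`, the step condition reads `k ≤ ε²`. Uniqueness follows by testing the difference of
two solutions with itself, as `f(s) + s = s³` is strictly increasing. Energy decay follows by
testing with `u - uₙ` and using `W'' ≥ -1` (`W_sub_le`). -/

theorem isOpenQuotientMap_proj : IsOpenQuotientMap Torus.proj :=
  IsOpenQuotientMap.piMap fun _ => QuotientAddGroup.isOpenQuotientMap_mk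

theorem proj_add (x y : Fin 2 → ℝ) : Torus.proj (x + y) = Torus.proj x + Torus.proj y := by
  ext i; simp [Torus.proj]

theorem proj_zero : Torus.proj 0 = 0 := by
  ext i; simp [Torus.proj]

theorem continuous_of_comp_proj {φ : Torus → ℝ} (h : Continuous fun x => φ (Torus.proj x)) :
    Continuous φ :=
  isOpenQuotientMap_proj.isQuotientMap.continuous_iff.2 h

theorem IsSmooth.continuous {φ : Torus → ℝ} (h : IsSmooth φ) : Continuous φ :=
  continuous_of_comp_proj (ContDiff.continuous h)

/-- `φ` has the directional derivative `φ'` along the `i`-th coordinate at every point. -/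
def HasPartial (i : Fin 2) (φ φ' : Torus → ℝ) : Prop :=
  ∀ p, HasDerivAt (fun s : ℝ => φ (p + Torus.proj (Pi.single i s))) (φ' p) 0

theorem HasPartial.hasDerivAt {i : Fin 2} {φ φ' : Torus → ℝ} (h : HasPartial i φ φ')
    (p : Torus) (s : ℝ) :
    HasDerivAt (fun s : ℝ => φ (p + Torus.proj (Pi.single i s)))
      (φ' (p + Torus.proj (Pi.single i s))) s := by
  have h1 := h (p + Torus.proj (Pi.single i s))
  rw [← sub_self s] at h1
  have h2 := h1.comp_sub_const s s
  refine h2.congr_of_eventuallyEq (Eventually.of_forall fun t => ?_)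
  simp only [add_assoc, ← proj_add, ← Pi.single_add]
  congr 4; ring_nf

theorem HasPartial.partialDeriv_eq {i : Fin 2} {φ φ' : Torus → ℝ} (h : HasPartial i φ φ') :
    partialDeriv i φ = φ' :=
  funext fun p => (h p).deriv

theorem HasPartial.mul {i : Fin 2} {φ φ' ψ ψ' : Torus → ℝ} (h : HasPartial i φ φ')
    (h' : HasPartial i ψ ψ') : HasPartial i (fun p => φ p * ψ p) (fun p => φ' p * ψ p + φ p * ψ' p) := by
  intro p
  have := (h p).mul (h' p)
  simpa [proj_zero] using! this

theorem IsSmooth.hasDerivAt_lift {φ : Torus → ℝ} (h : IsSmooth φ) (i : Fin 2) (x : Fin 2 → ℝ) :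
    HasDerivAt (fun s : ℝ => φ (Torus.proj x + Torus.proj (Pi.single i s)))
      (fderiv ℝ (fun y => φ (Torus.proj y)) x (Pi.single i 1)) 0 := by
  have h1 : HasFDerivAt (fun y => φ (Torus.proj y)) (fderiv ℝ (fun y => φ (Torus.proj y)) x)
      (x + (0 : ℝ) • (Pi.single i 1 : Fin 2 → ℝ)) := by
    rw [zero_smul, add_zero]
    exact (ContDiff.differentiable h (by simp) x).hasFDerivAt
  have h2 : HasDerivAt (fun s : ℝ => x + s • (Pi.single i 1 : Fin 2 → ℝ)) (Pi.single i 1) 0 := by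
    simpa using ((hasDerivAt_id (0 : ℝ)).smul_const (Pi.single i 1 : Fin 2 → ℝ)).const_add x
  refine (h1.comp_hasDerivAt (0 : ℝ) h2).congr_of_eventuallyEq (Eventually.of_forall fun s => ?_)
  simp [← proj_add, ← Pi.single_smul]

theorem IsSmooth.hasPartial {φ : Torus → ℝ} (h : IsSmooth φ) (i : Fin 2) :
    HasPartial i φ (partialDeriv i φ) := by
  intro p
  obtain ⟨x, rfl⟩ := isOpenQuotientMap_proj.surjective p
  exact (h.hasDerivAt_lift i x).differentiableAt.hasDerivAt

theorem IsSmooth.continuous_partialDeriv {φ : Torus → ℝ} (h : IsSmooth φ) (i : Fin 2) :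
    Continuous (partialDeriv i φ) := by
  refine continuous_of_comp_proj ?_
  have : (fun x => partialDeriv i φ (Torus.proj x)) =
      fun x => fderiv ℝ (fun y => φ (Torus.proj y)) x (Pi.single i 1) :=
    funext fun x => (h.hasDerivAt_lift i x).deriv
  rw [this]
  exact (ContDiff.continuous_fderiv h (by simp)).clm_apply continuous_const

/-! ### Integration by parts for continuously differentiable functions -/

theorem integrable_of_continuous {φ : Torus → ℝ} (h : Continuous φ) : Integrable φ volume :=
  h.integrable_of_hasCompactSupport (HasCompactSupport.of_compactSpace φ)

/-- Translation invariance makes `s ↦ ∫ φ(p + s eᵢ)` constant; differentiating under the integral at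
`0` gives the claim. -/
theorem HasPartial.integral_eq_zero {i : Fin 2} {φ φ' : Torus → ℝ} (h : HasPartial i φ φ')
    (hφ : Continuous φ) (hφ' : Continuous φ') : ∫ p, φ' p = 0 := by
  obtain ⟨C, hC⟩ := isCompact_univ.exists_bound_of_continuousOn hφ'.continuousOn
  have h1 := (hasDerivAt_integral_of_dominated_loc_of_deriv_le
    (F := fun (s : ℝ) p => φ (p + Torus.proj (Pi.single i s)))
    (F' := fun (s : ℝ) p => φ' (p + Torus.proj (Pi.single i s)))
    (μ := (volume : Measure Torus)) (x₀ := 0) (s := Set.univ) (bound := fun _ => C)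
    univ_mem
    (Eventually.of_forall fun s => (integrable_of_continuous
      (hφ.comp (continuous_add_const _))).aestronglyMeasurable)
    (integrable_of_continuous (hφ.comp (continuous_add_const _)))
    (integrable_of_continuous (hφ'.comp (continuous_add_const _))).aestronglyMeasurable
    (Eventually.of_forall fun p s _ => hC _ (Set.mem_univ _))
    (integrable_const _)
    (Eventually.of_forall fun p s _ => h.hasDerivAt p s)).2
  have h2 : (fun s : ℝ => ∫ p, φ (p + Torus.proj (Pi.single i s))) = fun _ => ∫ p, φ p :=
    funext fun s => integral_add_right_eq_self φ _
  rw [h2] at h1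
  have h3 := h1.unique (hasDerivAt_const _ _)
  simpa [proj_zero] using h3

theorem HasPartial.integral_mul {i : Fin 2} {φ φ' ψ ψ' : Torus → ℝ} (h : HasPartial i φ φ')
    (h' : HasPartial i ψ ψ') (hφ : Continuous φ) (hφ' : Continuous φ')
    (hψ : Continuous ψ) (hψ' : Continuous ψ') :
    ∫ p, φ p * ψ' p = - ∫ p, φ' p * ψ p := by
  have := (h.mul h').integral_eq_zero (hφ.mul hψ) ((hφ'.mul hψ).add (hφ.mul hψ'))
  rw [integral_add (f := fun p => φ' p * ψ p) (g := fun p => φ p * ψ' p)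
    (integrable_of_continuous (hφ'.mul hψ)) (integrable_of_continuous (hφ.mul hψ'))] at this
  linarith

theorem HasPartial.isWeakPartial {i : Fin 2} {φ φ' : Torus → ℝ} (h : HasPartial i φ φ')
    (hφ : Continuous φ) (hφ' : Continuous φ') : IsWeakPartial i φ φ' := fun _ hψ =>
  h.integral_mul (hψ.hasPartial i) hφ hφ' hψ.continuous (hψ.continuous_partialDeriv i)

/-! ### Trigonometric polynomials -/

/-- The character `exp (i n·x)` of the torus. -/
def character (n : Fin 2 → ℤ) : C(Torus, ℂ) where
  toFun p := ∏ i, fourier (n i) (p i)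
  continuous_toFun := by fun_prop

theorem character_apply_add (n : Fin 2 → ℤ) (p q : Torus) :
    character n (p + q) = character n p * character n q := by
  simp [character, fourier_apply, smul_add, AddCircle.toCircle_add]
  ring

theorem character_proj (n : Fin 2 → ℤ) (x : Fin 2 → ℝ) :
    character n (Torus.proj x) = Complex.exp (∑ i, Complex.I * n i * x i) := by
  rw [Complex.exp_sum]
  change ∏ i, fourier (n i) (Torus.proj x i) = _
  refine Finset.prod_congr rfl fun i _ => ?_
  have h : (Real.pi : ℂ) ≠ 0 := by exact_mod_cast Real.pi_ne_zero
  simp only [Torus.proj]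
  rw [fourier_coe_apply]
  congr 1
  push_cast
  field_simp

theorem character_proj_single (n : Fin 2 → ℤ) (i : Fin 2) (s : ℝ) :
    character n (Torus.proj (Pi.single i s)) = Complex.exp (Complex.I * n i * s) := by
  rw [character_proj, Finset.sum_eq_single i]
  · simp
  · intro j _ hj; simp [hj]
  · simp

/-- Stone–Weierstrass: products and conjugates of characters are characters, and the first mode in a
coordinate separates points differing there. -/
theorem span_character_closure_eq_top :
    (Submodule.span ℂ (Set.range character)).topologicalClosure = ⊤ := by
  have hmul : ∀ m n, character m * character n = character (m + n) := by
    intro m n; ext p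
    simp [character, fourier_apply, add_smul, AddCircle.toCircle_add, Finset.prod_mul_distrib]
  have hone : character 0 = 1 := by ext p; simp [character]
  have hstar : ∀ n, star (character n) = character (-n) := by
    intro n; ext p
    simp only [character, ContinuousMap.star_apply, ContinuousMap.coe_mk, Pi.neg_apply,
      fourier_neg, star_prod, RCLike.star_def]
  let A : StarSubalgebra ℂ C(Torus, ℂ) :=
    { toSubalgebra := Algebra.adjoin ℂ (Set.range character)
      star_mem' := by
        change Algebra.adjoin ℂ (Set.range character) ≤
          star (Algebra.adjoin ℂ (Set.range character))
        refine Algebra.adjoin_le ?_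
        rintro _ ⟨n, rfl⟩
        exact Algebra.subset_adjoin ⟨-n, (hstar n).symm⟩ }
  have hA : A.toSubalgebra.toSubmodule = Submodule.span ℂ (Set.range character) := by
    refine Algebra.adjoin_eq_span_of_subset (R := ℂ) (A := C(Torus, ℂ)) ?_
    refine .trans (fun x => Submonoid.closure_induction (fun _ => id) ⟨0, hone⟩ ?_)
      Submodule.subset_span
    rintro _ _ _ _ ⟨m, rfl⟩ ⟨n, rfl⟩
    exact ⟨m + n, (hmul m n).symm⟩
  have hsep : A.SeparatesPoints := by
    intro x y hxy
    obtain ⟨i, hi⟩ := Function.ne_iff.1 hxy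
    refine ⟨_, ⟨character (Pi.single i 1), Algebra.subset_adjoin ⟨_, rfl⟩, rfl⟩, ?_⟩
    have key : ∀ z : Torus, character (Pi.single i 1) z = fourier 1 (z i) := by
      intro z
      change ∏ j, fourier ((Pi.single i 1 : Fin 2 → ℤ) j) (z j) = _
      rw [Finset.prod_eq_single i]
      · simp
      · intro j _ hj; simp [hj]
      · simp
    simp only [key, fourier_one]
    intro h
    exact hi (AddCircle.injective_toCircle Real.two_pi_pos.ne' (Subtype.coe_injective h))
  rw [← hA]
  exact congr_arg (Subalgebra.toSubmodule <| StarSubalgebra.toSubalgebra ·)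
    (ContinuousMap.starSubalgebra_topologicalClosure_eq_top_of_separatesPoints A hsep)

/-- The coefficients of a trigonometric polynomial. -/
abbrev Coeff : Type := (Fin 2 → ℤ) →₀ ℂ

/-- The real trigonometric polynomial `Re ∑ cₙ exp (i n·x)`. -/
def trig : Coeff →ₗ[ℝ] C(Torus, ℝ) where
  toFun c := ⟨fun p => (Finsupp.linearCombination ℂ character c p).re, by fun_prop⟩
  map_add' c d := by ext p; simp
  map_smul' r c := by ext p; simp

theorem trig_apply (c : Coeff) (p : Torus) :
    trig c p = (∑ n ∈ c.support, c n * character n p).re := by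
  change (Finsupp.linearCombination ℂ character c p).re = _
  simp [Finsupp.linearCombination_apply, Finsupp.sum]

/-- Taking the real part of a complex approximant of a real function does not increase the error. -/
theorem denseRange_trig : DenseRange trig := by
  intro g
  rw [Metric.mem_closure_iff]
  intro δ hδ
  let G : C(Torus, ℂ) := ⟨fun p => (g p : ℂ), by fun_prop⟩
  have hG : G ∈ (Submodule.span ℂ (Set.range character)).topologicalClosure := by
    rw [span_character_closure_eq_top]; trivial
  obtain ⟨T, hT, hd⟩ := Metric.mem_closure_iff.1 hG δ hδ
  obtain ⟨c, rfl⟩ := (Finsupp.mem_span_range_iff_exists_finsupp).1 hT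
  refine ⟨trig c, ⟨c, rfl⟩, lt_of_le_of_lt ?_ hd⟩
  refine (ContinuousMap.dist_le dist_nonneg).2 fun p => ?_
  refine le_trans ?_ (ContinuousMap.dist_apply_le_dist p)
  rw [Real.dist_eq, dist_eq_norm]
  refine le_trans (le_of_eq ?_) (Complex.abs_re_le_norm _)
  rw [trig_apply]
  simp [G, Finsupp.sum]

/-- The Fourier multiplier of `∂ᵢ`. -/
def symb (i : Fin 2) : (Fin 2 → ℤ) → ℂ := fun n => Complex.I * n i

theorem trig_smul_apply (m : (Fin 2 → ℤ) → ℂ) (c : Coeff) (p : Torus) :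
    trig (m • c) p = (∑ n ∈ c.support, m n * c n * character n p).re := by
  rw [trig_apply]
  congr 1
  refine Finset.sum_subset (fun n hn => ?_) (fun n _ hn => ?_)
  · exact Finsupp.mem_support_iff.2 fun h => Finsupp.mem_support_iff.1 hn (by simp [h])
  · have : m n * c n = 0 := Finsupp.notMem_support_iff.1 hn
    simp [this]

theorem trig_hasPartial (i : Fin 2) (c : Coeff) : HasPartial i (trig c) (trig (symb i • c)) := by
  intro p
  have h1 : HasDerivAt (fun s : ℝ =>
      ∑ n ∈ c.support, c n * (character n p * Complex.exp (Complex.I * n i * s)))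
      (∑ n ∈ c.support, symb i n * c n * character n p) 0 := by
    refine HasDerivAt.fun_sum fun n _ => ?_
    have h2 : HasDerivAt (fun s : ℝ => Complex.I * n i * (s : ℂ)) (Complex.I * n i) 0 := by
      simpa using (Complex.ofRealCLM.hasDerivAt (x := 0)).const_mul (Complex.I * n i)
    have h3 := ((h2.cexp).const_mul (character n p)).const_mul (c n)
    refine h3.congr_deriv ?_
    simp only [symb, Complex.ofReal_zero, mul_zero, Complex.exp_zero]; ring
  have h4 := Complex.reCLM.hasFDerivAt.comp_hasDerivAt (0 : ℝ) h1
  rw [trig_smul_apply]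
  refine h4.congr_of_eventuallyEq (Eventually.of_forall fun s => ?_)
  simp [trig_apply, character_apply_add, character_proj_single]

theorem isSmooth_trig (c : Coeff) : IsSmooth (trig c) := by
  have : (fun x : Fin 2 → ℝ => trig c (Torus.proj x)) = fun x => Complex.reCLM
      (∑ n ∈ c.support, c n * Complex.exp (∑ i, Complex.I * n i * Complex.ofRealCLM (x i))) := by
    ext x; simp [trig_apply, character_proj]
  unfold IsSmooth
  rw [this]
  fun_prop

theorem partialDeriv_trig (i : Fin 2) (c : Coeff) :
    partialDeriv i (trig c) = trig (symb i • c) :=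
  (trig_hasPartial i c).partialDeriv_eq

theorem isWeakPartial_trig (i : Fin 2) (c : Coeff) :
    IsWeakPartial i (trig c) (trig (symb i • c)) :=
  (trig_hasPartial i c).isWeakPartial (map_continuous _) (map_continuous _)

/-! ### The operator `l - Δ` on trigonometric polynomials -/

/-- The Fourier multiplier of `l - Δ`. -/
def helm (l : ℝ) : (Fin 2 → ℤ) → ℂ := fun n => l - ∑ i, symb i n * symb i n

theorem helm_eq (l : ℝ) (n : Fin 2 → ℤ) : helm l n = ((l + ∑ i, (n i : ℝ) ^ 2 : ℝ) : ℂ) := by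
  simp only [helm, symb, Fin.sum_univ_two]
  push_cast
  linear_combination (-(n 0 : ℂ) ^ 2 - (n 1 : ℂ) ^ 2) * Complex.I_mul_I

theorem helm_ne_zero {l : ℝ} (hl : 0 < l) (n : Fin 2 → ℤ) : helm l n ≠ 0 := by
  rw [helm_eq]
  have : 0 < l + ∑ i, (n i : ℝ) ^ 2 := by positivity
  exact_mod_cast this.ne'

theorem helm_smul_inv {l : ℝ} (hl : 0 < l) (c : Coeff) : helm l • (helm l)⁻¹ • c = c := by
  ext n
  simp [helm_ne_zero hl n]

theorem trig_helm (l : ℝ) (c : Coeff) :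
    trig (helm l • c) = l • trig c - ∑ i, trig (symb i • symb i • c) := by
  rw [← map_smul, ← map_sum, ← map_sub]
  congr 1
  ext n
  simp [helm, sub_mul]
  ring

/-- If `g'' < 0`, the second derivative test makes the minimum also a local maximum, so `g` is
locally constant and `g'' = 0`. -/
theorem secondDeriv_nonneg_of_min {g g' : ℝ → ℝ} {g'' : ℝ} (h : ∀ s, HasDerivAt g (g' s) s)
    (h' : HasDerivAt g' g'' 0) (hmin : ∀ s, g 0 ≤ g s) : 0 ≤ g'' := by
  by_contra! hneg
  have hd : deriv g = g' := funext fun s => (h s).deriv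
  have hloc : IsLocalMin g 0 := Eventually.of_forall hmin
  have hmax : IsLocalMax g 0 := isLocalMax_of_deriv_deriv_neg (by rwa [hd, h'.deriv])
    hloc.deriv_eq_zero (h 0).continuousAt
  have hconst : g =ᶠ[𝓝 0] fun _ => g 0 := hmax.mono fun s hs => le_antisymm hs (hmin s)
  have h0 : g' =ᶠ[𝓝 0] fun _ => 0 := by
    have := hconst.deriv
    rw [hd] at this
    simpa using! this
  have := (h'.congr_of_eventuallyEq h0.symm).unique (hasDerivAt_const _ _)
  linarith

/-- The maximum principle for `l - Δ` on trigonometric polynomials. -/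
theorem trig_nonneg_of_helm_nonneg {l : ℝ} (hl : 0 < l) (c : Coeff)
    (h : ∀ p, 0 ≤ trig (helm l • c) p) (p : Torus) : 0 ≤ trig c p := by
  obtain ⟨q, -, hq⟩ := isCompact_univ.exists_isMinOn Set.univ_nonempty
    (map_continuous (trig c)).continuousOn
  have hq' : ∀ z, trig c q ≤ trig c z := fun z => hq (Set.mem_univ z)
  -- At the minimum the second derivatives are nonnegative, so `l * trig c q` is at least `trig
  -- (helm l • c) q`.
  have hi : ∀ i, 0 ≤ trig (symb i • symb i • c) q := by
    intro i
    refine secondDeriv_nonneg_of_min (g := fun s : ℝ => trig c (q + Torus.proj (Pi.single i s)))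
      (g' := fun s : ℝ => trig (symb i • c) (q + Torus.proj (Pi.single i s)))
      (fun s => (trig_hasPartial i c).hasDerivAt q s) (trig_hasPartial i _ q) fun s => ?_
    simpa [proj_zero] using hq' _
  have h1 := h q
  rw [trig_helm] at h1
  simp only [ContinuousMap.sub_apply, ContinuousMap.smul_apply, smul_eq_mul,
    ContinuousMap.sum_apply] at h1
  have h2 : 0 ≤ l * trig c q := by
    have := Finset.sum_nonneg fun i (_ : i ∈ Finset.univ) => hi i
    linarith
  exact (nonneg_of_mul_nonneg_right h2 hl).trans (hq' p)

/-! ### Square-integrable functions -/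

/-- The Hilbert space of square-integrable functions on the torus. -/
abbrev L2 : Type := Lp ℝ 2 (volume : Measure Torus)

/-- The inclusion of the continuous functions into `L²`. -/
def toL2 : C(Torus, ℝ) →L[ℝ] L2 := ContinuousMap.toLp 2 volume ℝ

theorem coeFn_toL2 (φ : C(Torus, ℝ)) : toL2 φ =ᵐ[volume] φ :=
  ContinuousMap.coeFn_toLp volume φ

theorem integral_mul_congr {u u' v v' : Torus → ℝ} (hu : u =ᵐ[volume] u') (hv : v =ᵐ[volume] v') :
    ∫ p, u p * v p = ∫ p, u' p * v' p :=
  integral_congr_ae (hu.mul hv)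

theorem inner_eq_integral (u v : L2) : inner ℝ u v = ∫ p, u p * v p := by
  rw [L2.inner_def]
  simp [mul_comm]

theorem inner_toL2 (u : L2) (φ : C(Torus, ℝ)) : inner ℝ u (toL2 φ) = ∫ p, u p * φ p := by
  rw [inner_eq_integral]
  exact integral_congr_ae ((coeFn_toL2 φ).mono fun p hp => by simp [hp])

theorem inner_toLp_left {w : Torus → ℝ} (hw : MemLp w 2 volume) (v : L2) :
    inner ℝ (hw.toLp w) v = ∫ p, w p * v p := by
  rw [inner_eq_integral]
  exact integral_congr_ae (hw.coeFn_toLp.mono fun p hp => by simp [hp])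

theorem integrable_mul_of_memLp {u v : Torus → ℝ} (hu : MemLp u 2 volume) (hv : MemLp v 2 volume) :
    Integrable (fun p => u p * v p) volume :=
  hu.integrable_mul hv

theorem memLp_of_continuous {φ : Torus → ℝ} (h : Continuous φ) : MemLp φ 2 volume :=
  (memLp_congr_ae (coeFn_toL2 ⟨φ, h⟩)).1 (Lp.memLp _)

/-- A trigonometric polynomial as an element of `L²`. -/
def trigL2 : Coeff →ₗ[ℝ] L2 := toL2.toLinearMap ∘ₗ trig

theorem trigL2_apply (c : Coeff) : trigL2 c = toL2 (trig c) := rfl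

theorem denseRange_trigL2 : DenseRange trigL2 :=
  (ContinuousMap.toLp_denseRange (α := Torus) (E := ℝ) (𝕜 := ℝ) (p := 2)
    (μ := volume) (by simp)).comp denseRange_trig toL2.continuous

theorem inner_trigL2_symb (i : Fin 2) (c d : Coeff) :
    inner ℝ (trigL2 c) (trigL2 (symb i • d)) = - inner ℝ (trigL2 (symb i • c)) (trigL2 d) := by
  simp only [trigL2_apply, inner_toL2]
  have h1 := isWeakPartial_trig i c (trig d) (isSmooth_trig d)
  rw [partialDeriv_trig] at h1
  rw [integral_mul_congr (coeFn_toL2 _) .rfl, h1, integral_mul_congr (coeFn_toL2 _) .rfl]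

theorem symb_comm (i j : Fin 2) (c : Coeff) : symb i • symb j • c = symb j • symb i • c := by
  rw [smul_smul, smul_smul, mul_comm]

/-- The `symb i` act as commuting skew-adjoint operators, so each cross term in the expanded square
becomes a squared norm with a favourable sign; in particular `⟨∂₀²b, ∂₁²b⟩ = ‖∂₁∂₀b‖²`. -/
theorem norm_sq_trigL2_helm (l : ℝ) (b : Coeff) :
    ‖trigL2 (helm l • b)‖ ^ 2 = l ^ 2 * ‖trigL2 b‖ ^ 2 + 2 * l * ∑ i, ‖trigL2 (symb i • b)‖ ^ 2
      + ∑ i, ∑ j, ‖trigL2 (symb j • symb i • b)‖ ^ 2 := by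
  have h0 : trigL2 (helm l • b) = l • trigL2 b - (trigL2 (symb 0 • symb 0 • b) +
      trigL2 (symb 1 • symb 1 • b)) := by
    simp only [trigL2_apply, trig_helm, map_sub, map_smul, Fin.sum_univ_two, map_add]
  have hx : ∀ i, inner ℝ (trigL2 b) (trigL2 (symb i • symb i • b)) = -‖trigL2 (symb i • b)‖ ^ 2 := by
    intro i
    rw [inner_trigL2_symb, real_inner_self_eq_norm_sq]
  have h01 : inner ℝ (trigL2 (symb 0 • symb 0 • b)) (trigL2 (symb 1 • symb 1 • b)) =
      ‖trigL2 (symb 1 • symb 0 • b)‖ ^ 2 := by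
    rw [inner_trigL2_symb, symb_comm 1 0, ← neg_eq_iff_eq_neg.2 (inner_trigL2_symb 0 _ _),
      symb_comm 0 1, neg_neg, real_inner_self_eq_norm_sq]
  rw [h0, norm_sub_sq_real, norm_add_sq_real, inner_add_right, real_inner_smul_left,
    real_inner_smul_left, hx, hx, h01, norm_smul, mul_pow, Real.norm_eq_abs, sq_abs]
  simp only [Fin.sum_univ_two]
  rw [symb_comm 0 1]
  ring

theorem le_of_sq_eq_sum {l x N : ℝ} {g : Fin 2 → ℝ} {k : Fin 2 → Fin 2 → ℝ} (hl : 0 < l)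
    (hN : 0 ≤ N)
    (h : N ^ 2 = l ^ 2 * x ^ 2 + 2 * l * ∑ i, g i ^ 2 + ∑ i, ∑ j, k i j ^ 2) :
    x ≤ l⁻¹ * N ∧ (∀ i, g i ≤ (√(2 * l))⁻¹ * N) ∧ ∀ i j, k i j ≤ 1 * N := by
  have h0 : 0 ≤ l ^ 2 * x ^ 2 := by positivity
  have h1 : 0 ≤ 2 * l * ∑ i, g i ^ 2 := by positivity
  have h2 : 0 ≤ ∑ i, ∑ j, k i j ^ 2 := by positivity
  refine ⟨?_, fun i => ?_, fun i j => ?_⟩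
  · rw [← div_eq_inv_mul, le_div_iff₀ hl]
    refine le_of_sq_le_sq ?_ hN
    linarith [mul_pow x l 2]
  · rw [← div_eq_inv_mul, le_div_iff₀ (by positivity)]
    refine le_of_sq_le_sq ?_ hN
    have h3 := Finset.single_le_sum (f := fun i => g i ^ 2) (fun _ _ => sq_nonneg _)
      (Finset.mem_univ i)
    rw [mul_pow, Real.sq_sqrt (by positivity)]
    have := mul_le_mul_of_nonneg_left h3 (by positivity : 0 ≤ 2 * l)
    linarith
  · rw [one_mul]
    refine le_of_sq_le_sq ?_ hN
    have h3 := Finset.single_le_sum (f := fun j => k i j ^ 2) (fun _ _ => sq_nonneg _)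
      (Finset.mem_univ j)
    have h4 := Finset.single_le_sum (f := fun i => ∑ j, k i j ^ 2)
      (fun _ _ => Finset.sum_nonneg fun _ _ => sq_nonneg _) (Finset.mem_univ i)
    linarith

theorem norm_trigL2_le {l : ℝ} (hl : 0 < l) (b : Coeff) :
    ‖trigL2 b‖ ≤ l⁻¹ * ‖trigL2 (helm l • b)‖ ∧
      (∀ i, ‖trigL2 (symb i • b)‖ ≤ (√(2 * l))⁻¹ * ‖trigL2 (helm l • b)‖) ∧
      ∀ i j, ‖trigL2 (symb j • symb i • b)‖ ≤ 1 * ‖trigL2 (helm l • b)‖ :=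
  le_of_sq_eq_sum (g := fun i => ‖trigL2 (symb i • b)‖)
    (k := fun i j => ‖trigL2 (symb j • symb i • b)‖) hl (norm_nonneg _) (norm_sq_trigL2_helm l b)

/-- With `B` the operator `l - Δ` and `A` a derivative of order at most two, convergence of the data
makes the derivatives of the approximate solutions Cauchy. -/
theorem exists_tendsto_of_norm_le {V E F : Type*} [AddCommGroup V] [Module ℝ V]
    [NormedAddCommGroup E] [NormedSpace ℝ E] [NormedAddCommGroup F] [NormedSpace ℝ F]
    [CompleteSpace F] (A : V →+ F) (B : V →+ E) {C : ℝ} (h : ∀ x, ‖A x‖ ≤ C * ‖B x‖)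
    {c : ℕ → V} {g : E} (hc : Tendsto (fun m => B (c m)) atTop (𝓝 g)) :
    ∃ a, Tendsto (fun m => A (c m)) atTop (𝓝 a) := by
  refine cauchySeq_tendsto_of_complete (cauchySeq_iff_tendsto_dist_atTop_0.2 ?_)
  have h1 := (cauchySeq_iff_tendsto_dist_atTop_0.1 hc.cauchySeq).const_mul C
  rw [mul_zero] at h1
  refine squeeze_zero (fun _ => dist_nonneg) (fun n => ?_) h1
  simpa only [dist_eq_norm, ← map_sub] using h (c n.1 - c n.2)

/-- The multiplier `m` followed by the inclusion into `L²`. -/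
def multL2 (m : (Fin 2 → ℤ) → ℂ) : Coeff →+ L2 where
  toFun c := trigL2 (m • c)
  map_zero' := by rw [show m • (0 : Coeff) = 0 by ext; simp, map_zero]
  map_add' c d := by
    rw [show m • (c + d) = m • c + m • d by ext; simp [mul_add], map_add]

/-- Approximate `g` by trigonometric polynomials, divide their coefficients by the symbol of `l -
Δ`, and pass to the limit. -/
theorem exists_trig_approx {l : ℝ} (hl : 0 < l) (g : L2) :
    ∃ (b : ℕ → Coeff) (u : L2) (G : Fin 2 → L2) (K : Fin 2 → Fin 2 → L2),
      Tendsto (fun m => trigL2 (b m)) atTop (𝓝 u) ∧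
      (∀ i, Tendsto (fun m => trigL2 (symb i • b m)) atTop (𝓝 (G i))) ∧
      (∀ i j, Tendsto (fun m => trigL2 (symb j • symb i • b m)) atTop (𝓝 (K i j))) ∧
      l • u - ∑ i, K i i = g := by
  obtain ⟨x, hx, hlim⟩ := mem_closure_iff_seq_limit.1 (denseRange_trigL2 g)
  choose c hc using hx
  let b : ℕ → Coeff := fun m => (helm l)⁻¹ • c m
  have hb : Tendsto (fun m => multL2 (helm l) (b m)) atTop (𝓝 g) := by
    refine hlim.congr fun m => ?_
    change _ = trigL2 (helm l • (helm l)⁻¹ • c m)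
    rw [helm_smul_inv hl, hc]
  obtain ⟨u, hu⟩ := exists_tendsto_of_norm_le trigL2.toAddMonoidHom _
    (fun b => (norm_trigL2_le hl b).1) hb
  choose G hG using fun i =>
    exists_tendsto_of_norm_le (multL2 (symb i)) _
      (fun b => (norm_trigL2_le hl b).2.1 i) hb
  have h2 : ∀ i j, ∃ a, Tendsto (fun m => trigL2 (symb j • symb i • b m)) atTop (𝓝 a) := by
    intro i j
    simp only [smul_smul]
    refine exists_tendsto_of_norm_le (multL2 (symb j * symb i)) _ (C := 1) (fun x => ?_) hb
    have := (norm_trigL2_le hl x).2.2 i j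
    rwa [smul_smul] at this
  choose K hK using h2
  refine ⟨b, u, G, K, hu, hG, hK, tendsto_nhds_unique ?_ hb⟩
  have h3 : ∀ m, multL2 (helm l) (b m) =
      l • trigL2 (b m) - ∑ i, trigL2 (symb i • symb i • b m) := by
    intro m
    change trigL2 _ = _
    simp only [trigL2_apply, trig_helm, map_sub, map_smul, map_sum]
  simp only [h3]
  exact (hu.const_smul l).sub (tendsto_finsetSum _ fun i _ => hK i i)

/-! ### Weak derivatives -/

theorem IsWeakPartial.congr {i : Fin 2} {u u' g g' : Torus → ℝ} (h : IsWeakPartial i u g)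
    (hu : u =ᵐ[volume] u') (hg : g =ᵐ[volume] g') : IsWeakPartial i u' g' := by
  intro φ hφ
  rw [integral_mul_congr hu.symm .rfl, h φ hφ, integral_mul_congr hg .rfl]

/-- For a fixed test function both sides of the weak identity are `L²` inner products, hence
continuous in `u` and `g`. -/
theorem isWeakPartial_of_tendsto {i : Fin 2} {b : ℕ → Coeff} {u g : L2}
    (hu : Tendsto (fun m => trigL2 (b m)) atTop (𝓝 u))
    (hg : Tendsto (fun m => trigL2 (symb i • b m)) atTop (𝓝 g)) : IsWeakPartial i u g := by
  intro φ hφ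
  let φ₀ : C(Torus, ℝ) := ⟨φ, hφ.continuous⟩
  let φ₁ : C(Torus, ℝ) := ⟨partialDeriv i φ, hφ.continuous_partialDeriv i⟩
  have h1 : Tendsto (fun m => inner ℝ (trigL2 (b m)) (toL2 φ₁)) atTop (𝓝 (inner ℝ u (toL2 φ₁))) :=
    hu.inner tendsto_const_nhds
  have h2 : Tendsto (fun m => -inner ℝ (trigL2 (symb i • b m)) (toL2 φ₀)) atTop
      (𝓝 (-inner ℝ g (toL2 φ₀))) :=
    (hg.inner tendsto_const_nhds).neg
  have h3 : ∀ m, inner ℝ (trigL2 (b m)) (toL2 φ₁) = -inner ℝ (trigL2 (symb i • b m)) (toL2 φ₀) := by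
    intro m
    rw [inner_toL2, inner_toL2]
    exact ((isWeakPartial_trig i (b m)).congr (coeFn_toL2 _).symm (coeFn_toL2 _).symm) φ hφ
  have h4 := tendsto_nhds_unique (h1.congr h3) h2
  rwa [inner_toL2, inner_toL2] at h4

theorem HasWeakPartialL2.memLp {i : Fin 2} {u : Torus → ℝ} (h : HasWeakPartialL2 i u) :
    MemLp (weakPartial i u) 2 volume := by
  rw [weakPartial, dif_pos h]
  exact h.choose_spec.1

theorem HasWeakPartialL2.isWeakPartial {i : Fin 2} {u : Torus → ℝ} (h : HasWeakPartialL2 i u) :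
    IsWeakPartial i u (weakPartial i u) := by
  rw [weakPartial, dif_pos h]
  exact h.choose_spec.2

/-! ### Nonnegativity through test functions -/

theorem toL2_sup_zero (φ : C(Torus, ℝ)) : toL2 (φ ⊔ 0) = toL2 φ ⊔ 0 := by
  refine Lp.ext ?_
  filter_upwards [coeFn_toL2 (φ ⊔ 0), coeFn_toL2 φ, Lp.coeFn_sup (toL2 φ) 0,
    Lp.coeFn_zero ℝ 2 (volume : Measure Torus)] with p h1 h2 h3 h4
  rw [h1, h3]
  simp [h2]

/-- Density extends the hypothesis to continuous and then to `L²` nonnegative test functions;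
testing with the negative part of `w` shows that it vanishes. -/
theorem nonneg_of_trig {w : L2} (h : ∀ c, (∀ p, 0 ≤ trig c p) → 0 ≤ inner ℝ w (trigL2 c)) :
    0 ≤ w := by
  have h1 : ∀ φ : C(Torus, ℝ), 0 ≤ φ → 0 ≤ inner ℝ w (toL2 φ) := by
    intro φ hφ
    have hmem : φ ∈ closure {ψ | ∃ c, trig c = ψ ∧ ∀ p, 0 ≤ trig c p} := by
      rw [Metric.mem_closure_iff]
      intro δ hδ
      -- Raising `φ` by `δ/3` before approximating within `δ/3` keeps the polynomial nonnegative;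
      -- the total error is at most `2δ/3`.
      obtain ⟨_, ⟨c, rfl⟩, hc⟩ := Metric.mem_closure_iff.1
        (denseRange_trig (φ + ContinuousMap.const _ (δ / 3))) (δ / 3) (by positivity)
      have hcp : ∀ p, |φ p + δ / 3 - trig c p| < δ / 3 := fun p =>
        (ContinuousMap.dist_apply_le_dist (f := φ + ContinuousMap.const _ (δ / 3)) p).trans_lt hc
      refine ⟨_, ⟨c, rfl, fun p => ?_⟩, ?_⟩
      · have h2 := (abs_lt.1 (hcp p)).2
        have h3 : 0 ≤ φ p := hφ p
        linarith
      · refine ((ContinuousMap.dist_le (C := 2 * δ / 3) (by positivity)).2 fun p => ?_).trans_lt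
          (by linarith)
        have h2 := abs_lt.1 (hcp p)
        rw [Real.dist_eq, abs_le]
        constructor <;> linarith
    have hcl : IsClosed {ψ : C(Torus, ℝ) | 0 ≤ inner ℝ w (toL2 ψ)} :=
      isClosed_le continuous_const (continuous_const.inner toL2.continuous)
    refine closure_minimal ?_ hcl hmem
    rintro _ ⟨c, rfl, hc⟩
    exact h c hc
  have h2 : ∀ v : L2, 0 ≤ v → 0 ≤ inner ℝ w v := by
    intro v hv
    have hmem : v ∈ closure (toL2 '' {φ | 0 ≤ φ}) := by
      rw [Metric.mem_closure_iff]
      intro δ hδ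
      obtain ⟨_, ⟨φ, rfl⟩, hd⟩ := Metric.mem_closure_iff.1
        (ContinuousMap.toLp_denseRange (α := Torus) (E := ℝ) (𝕜 := ℝ) (p := 2)
          (μ := volume) (by simp) v) δ hδ
      -- Taking positive parts is 1-Lipschitz and fixes `v`, so the approximation does not get
      -- worse.
      refine ⟨_, ⟨φ ⊔ 0, (le_sup_right : 0 ≤ φ ⊔ 0), rfl⟩, lt_of_le_of_lt ?_ hd⟩
      rw [toL2_sup_zero, dist_eq_norm, dist_eq_norm]
      have := norm_sup_sub_sup_le_norm v (toL2 φ) 0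
      rwa [sup_eq_left.2 hv] at this
    have hcl : IsClosed {v : L2 | 0 ≤ inner ℝ w v} :=
      isClosed_le continuous_const (continuous_const.inner continuous_id)
    refine closure_minimal ?_ hcl hmem
    rintro _ ⟨φ, hφ, rfl⟩
    exact h1 φ hφ
  have h3 := h2 (-w ⊔ 0) le_sup_right
  have h4 : inner ℝ w (-w ⊔ 0) = - inner ℝ (-w ⊔ 0) (-w ⊔ 0) := by
    rw [inner_eq_integral, inner_eq_integral, ← integral_neg]
    refine integral_congr_ae ?_
    filter_upwards [Lp.coeFn_sup (-w) 0, Lp.coeFn_neg w,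
      Lp.coeFn_zero ℝ 2 (volume : Measure Torus)] with p h5 h6 h7
    rw [h5]
    simp only [Pi.sup_apply, h6, h7, Pi.neg_apply, Pi.zero_apply]
    rcases le_total (-w p) 0 with h8 | h8
    · simp [h8]
    · rw [sup_eq_left.2 h8]; ring
  have h5 : -w ⊔ 0 = 0 := by
    rw [← real_inner_self_nonpos]
    linarith
  exact neg_nonpos.1 (sup_eq_right.1 h5)

theorem inner_toLp_trigL2 {w : Torus → ℝ} (hw : MemLp w 2 volume) (c : Coeff) :
    inner ℝ (hw.toLp w) (trigL2 c) = ∫ p, w p * trig c p := by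
  rw [inner_toLp_left]
  exact integral_congr_ae ((coeFn_toL2 (trig c)).mono fun p hp => by
    change _ * toL2 (trig c) p = _; rw [hp])

theorem ae_nonneg_of_trig {w : Torus → ℝ} (hw : MemLp w 2 volume)
    (h : ∀ c, (∀ p, 0 ≤ trig c p) → 0 ≤ ∫ p, w p * trig c p) : ∀ᵐ p, 0 ≤ w p := by
  have h1 : 0 ≤ hw.toLp w := nonneg_of_trig fun c hc => by
    rw [inner_toLp_trigL2]; exact h c hc
  filter_upwards [hw.coeFn_toLp, (Lp.coeFn_nonneg _).2 h1] with p h2 h3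
  rwa [h2] at h3

theorem ae_eq_of_trig {v w : Torus → ℝ} (hv : MemLp v 2 volume) (hw : MemLp w 2 volume)
    (h : ∀ c, ∫ p, v p * trig c p = ∫ p, w p * trig c p) : v =ᵐ[volume] w := by
  have h0 : ∀ {v w : Torus → ℝ} (hv : MemLp v 2 volume) (hw : MemLp w 2 volume) (c : Coeff),
      ∫ p, (v - w) p * trig c p = (∫ p, v p * trig c p) - ∫ p, w p * trig c p := by
    intro v w hv hw c
    have hc := memLp_of_continuous (map_continuous (trig c))
    rw [← integral_sub (integrable_mul_of_memLp hv hc) (integrable_mul_of_memLp hw hc)]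
    simp [sub_mul]
  have h1 := ae_nonneg_of_trig (hv.sub hw) fun c _ => by rw [h0 hv hw, h c, sub_self]
  have h2 := ae_nonneg_of_trig (hw.sub hv) fun c _ => by rw [h0 hw hv, h c, sub_self]
  filter_upwards [h1, h2] with p h3 h4
  exact le_antisymm (sub_nonneg.1 h4) (sub_nonneg.1 h3)

theorem IsWeakPartial.ae_eq {i : Fin 2} {u g g' : Torus → ℝ} (h : IsWeakPartial i u g)
    (h' : IsWeakPartial i u g') (hg : MemLp g 2 volume) (hg' : MemLp g' 2 volume) :
    g =ᵐ[volume] g' := by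
  refine ae_eq_of_trig hg hg' fun c => neg_injective ?_
  rw [← h _ (isSmooth_trig c), ← h' _ (isSmooth_trig c)]

theorem IsWeakPartial.weakPartial_ae_eq {i : Fin 2} {u g : Torus → ℝ} (h : IsWeakPartial i u g)
    (hg : MemLp g 2 volume) : weakPartial i u =ᵐ[volume] g :=
  have h' : HasWeakPartialL2 i u := ⟨g, hg, h⟩
  h'.isWeakPartial.ae_eq h h'.memLp hg

/-! ### The equation `l u - Δu = g` in `H²` -/

theorem MemH2.memLp {u : Torus → ℝ} (h : MemH2 u) : MemLp u 2 volume := h.1.1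

theorem MemH2.memLp_weakPartial {u : Torus → ℝ} (h : MemH2 u) (i : Fin 2) :
    MemLp (weakPartial i u) 2 volume := (h.1.2 i).memLp

theorem MemH2.memLp_laplacian {u : Torus → ℝ} (h : MemH2 u) : MemLp (laplacian u) 2 volume :=
  memLp_finsetSum _ fun i _ => ((h.2 i).2 i).memLp

theorem MemH2.integral_mul_trig_helm {u : Torus → ℝ} (h : MemH2 u) (l : ℝ) (c : Coeff) :
    ∫ p, u p * trig (helm l • c) p = ∫ p, (l * u p - laplacian u p) * trig c p := by
  have h1 : ∀ i, ∫ p, u p * trig (symb i • symb i • c) p =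
      ∫ p, weakPartial i (weakPartial i u) p * trig c p := by
    intro i
    have h2 := (h.1.2 i).isWeakPartial _ (isSmooth_trig (symb i • c))
    have h3 := ((h.2 i).2 i).isWeakPartial _ (isSmooth_trig c)
    rw [partialDeriv_trig] at h2 h3
    rw [h2, h3, neg_neg]
  have hc := fun c => memLp_of_continuous (map_continuous (trig c))
  have e1 : ∀ p, u p * trig (helm l • c) p =
      l * (u p * trig c p) - ∑ i, u p * trig (symb i • symb i • c) p := by
    intro p
    rw [trig_helm]
    simp only [ContinuousMap.sub_apply, ContinuousMap.smul_apply, smul_eq_mul,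
      ContinuousMap.sum_apply, ← Finset.mul_sum]
    ring
  have e2 : ∀ p, (l * u p - laplacian u p) * trig c p =
      l * (u p * trig c p) - ∑ i, weakPartial i (weakPartial i u) p * trig c p := by
    intro p
    rw [← Finset.sum_mul, laplacian]
    ring
  simp only [e1, e2]
  rw [integral_sub ((integrable_mul_of_memLp h.memLp (hc c)).const_mul l)
      (integrable_finsetSum _ fun i _ => integrable_mul_of_memLp h.memLp (hc _)),
    integral_sub ((integrable_mul_of_memLp h.memLp (hc c)).const_mul l)
      (integrable_finsetSum _ fun i _ => integrable_mul_of_memLp ((h.2 i).2 i).memLp (hc _)),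
    integral_finsetSum _ fun i _ => integrable_mul_of_memLp h.memLp (hc _),
    integral_finsetSum _ fun i _ => integrable_mul_of_memLp ((h.2 i).2 i).memLp (hc _)]
  simp only [h1]

/-- `u` is a very weak solution of `l u - Δu = g`: all derivatives are on the test function. -/
def IsVeryWeak (l : ℝ) (u g : Torus → ℝ) : Prop :=
  ∀ c, ∫ p, u p * trig (helm l • c) p = ∫ p, g p * trig c p

theorem MemH2.isVeryWeak {u : Torus → ℝ} (h : MemH2 u) {l : ℝ} {g : Torus → ℝ}
    (hu : ∀ᵐ p, l * u p - laplacian u p = g p) : IsVeryWeak l u g := fun c => by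
  rw [h.integral_mul_trig_helm]
  exact integral_mul_congr hu .rfl

/-- Constants are the barriers in the comparison argument. -/
theorem isVeryWeak_const (l a : ℝ) : IsVeryWeak l (fun _ => a) (fun _ => l * a) := by
  intro c
  have h1 : ∀ i, ∫ p, trig (symb i • symb i • c) p = 0 := fun i =>
    (trig_hasPartial i (symb i • c)).integral_eq_zero (map_continuous _) (map_continuous _)
  have hc := fun c => integrable_of_continuous (map_continuous (trig c))
  rw [trig_helm, integral_const_mul, integral_const_mul]
  simp only [ContinuousMap.sub_apply, ContinuousMap.smul_apply, smul_eq_mul,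
    ContinuousMap.sum_apply]
  rw [integral_sub ((hc c).const_mul l) (integrable_finsetSum _ fun i _ => hc _),
    integral_const_mul, integral_finsetSum _ fun i _ => hc _]
  simp only [h1, Finset.sum_const_zero]
  ring

/-- The comparison principle for `l - Δ`. -/
theorem IsVeryWeak.ae_le {l : ℝ} (hl : 0 < l) {u v g h : Torus → ℝ} (hu : MemLp u 2 volume)
    (hv : MemLp v 2 volume) (hg : MemLp g 2 volume) (hh : MemLp h 2 volume)
    (hug : IsVeryWeak l u g) (hvh : IsVeryWeak l v h) (hgh : g ≤ᵐ[volume] h) :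
    u ≤ᵐ[volume] v := by
  have hc := fun c => memLp_of_continuous (map_continuous (trig c))
  have key := ae_nonneg_of_trig (hv.sub hu) fun c hcp => by
    -- Duality: testing the equations with `(l - Δ)⁻¹` of a nonnegative polynomial, itself
    -- nonnegative by the maximum principle, moves the sign of `h - g` onto `v - u`.
    have h1 := hug ((helm l)⁻¹ • c)
    have h2 := hvh ((helm l)⁻¹ • c)
    rw [helm_smul_inv hl] at h1 h2
    simp only [Pi.sub_apply, sub_mul]
    rw [integral_sub (integrable_mul_of_memLp hv (hc _)) (integrable_mul_of_memLp hu (hc _)),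
      h1, h2, ← integral_sub (integrable_mul_of_memLp hh (hc _))
      (integrable_mul_of_memLp hg (hc _))]
    refine integral_nonneg_of_ae ?_
    filter_upwards [hgh] with p hp
    rw [← sub_mul]
    exact mul_nonneg (sub_nonneg.2 hp) (trig_nonneg_of_helm_nonneg hl _
      (fun q => by rw [helm_smul_inv hl]; exact hcp q) p)
  filter_upwards [key] with p hp
  exact sub_nonneg.1 hp

theorem IsVeryWeak.ae_eq {l : ℝ} (hl : 0 < l) {u v g : Torus → ℝ} (hu : MemLp u 2 volume)
    (hv : MemLp v 2 volume) (hg : MemLp g 2 volume)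
    (hug : IsVeryWeak l u g) (hvg : IsVeryWeak l v g) : u =ᵐ[volume] v :=
  (hug.ae_le hl hu hv hg hg hvg .rfl).antisymm (hvg.ae_le hl hv hu hg hg hug .rfl)

/-- The approximating polynomials are kept alongside the solution because they supply the density
used in `MemH2.integral_mul`. -/
theorem exists_memH2_approx {l : ℝ} (hl : 0 < l) {g : Torus → ℝ} (hg : MemLp g 2 volume) :
    ∃ (u : L2) (b : ℕ → Coeff) (G : Fin 2 → L2), MemH2 u ∧
      (∀ᵐ p, l * u p - laplacian u p = g p) ∧
      Tendsto (fun m => trigL2 (b m)) atTop (𝓝 u) ∧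
      (∀ i, Tendsto (fun m => trigL2 (symb i • b m)) atTop (𝓝 (G i))) := by
  obtain ⟨b, u, G, K, hu, hG, hK, hsum⟩ := exists_trig_approx hl (hg.toLp g)
  have hw : ∀ i, IsWeakPartial i u (G i) := fun i => isWeakPartial_of_tendsto hu (hG i)
  have hGi : ∀ i, weakPartial i u =ᵐ[volume] G i := fun i => (hw i).weakPartial_ae_eq (Lp.memLp _)
  have hw2 : ∀ i j, IsWeakPartial j (weakPartial i u) (K i j) := fun i j =>
    (isWeakPartial_of_tendsto (hG i) (hK i j)).congr (hGi i).symm .rfl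
  have hKi : ∀ i j, weakPartial j (weakPartial i u) =ᵐ[volume] K i j := fun i j =>
    (hw2 i j).weakPartial_ae_eq (Lp.memLp _)
  refine ⟨u, b, G, ⟨⟨Lp.memLp _, fun i => ⟨G i, Lp.memLp _, hw i⟩⟩, fun i =>
    ⟨(memLp_congr_ae (hGi i)).2 (Lp.memLp _), fun j => ⟨K i j, Lp.memLp _, hw2 i j⟩⟩⟩, ?_, hu, hG⟩
  rw [Fin.sum_univ_two] at hsum
  filter_upwards [hKi 0 0, hKi 1 1, hg.coeFn_toLp, Lp.coeFn_sub (l • u) (K 0 0 + K 1 1),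
    Lp.coeFn_smul l u, Lp.coeFn_add (K 0 0) (K 1 1)] with p h1 h2 h3 h4 h5 h6
  rw [hsum, h3] at h4
  rw [h4]
  rw [Pi.sub_apply, h5, h6, laplacian, Fin.sum_univ_two, h1, h2]
  rfl

/-- Integration by parts against functions in `H²`. -/
theorem MemH2.integral_mul {w : Torus → ℝ} (hw : MemH2 w) {i : Fin 2} {u g : Torus → ℝ}
    (h : IsWeakPartial i u g) (hu : MemLp u 2 volume) (hg : MemLp g 2 volume) :
    ∫ p, g p * w p = - ∫ p, u p * weakPartial i w p := by
  -- By uniqueness `w` is the constructed solution with data `w - Δw`, so trigonometric polynomials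
  -- converge to it together with their first derivatives and may stand in as test functions.
  have hmem : MemLp (fun p => 1 * w p - laplacian w p) 2 volume :=
    (hw.memLp.const_mul 1).sub hw.memLp_laplacian
  obtain ⟨v, b, G, hv, hsol, hb, hG⟩ := exists_memH2_approx one_pos hmem
  have hvw : v =ᵐ[volume] w := (hv.isVeryWeak hsol).ae_eq one_pos hv.memLp hw.memLp hmem
    (hw.isVeryWeak (.of_forall fun _ => rfl))
  have hGi : G i =ᵐ[volume] weakPartial i w :=
    ((isWeakPartial_of_tendsto hb (hG i)).congr hvw .rfl).weakPartial_ae_eq (Lp.memLp _) |>.symm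
  have h1 : Tendsto (fun m => inner ℝ (hg.toLp g) (trigL2 (b m))) atTop
      (𝓝 (inner ℝ (hg.toLp g) v)) := tendsto_const_nhds.inner hb
  have h2 : Tendsto (fun m => -inner ℝ (hu.toLp u) (trigL2 (symb i • b m))) atTop
      (𝓝 (-inner ℝ (hu.toLp u) (G i))) := (tendsto_const_nhds.inner (hG i)).neg
  have h3 : ∀ m, -inner ℝ (hu.toLp u) (trigL2 (symb i • b m)) =
      inner ℝ (hg.toLp g) (trigL2 (b m)) := by
    intro m
    rw [inner_toLp_trigL2, inner_toLp_trigL2, ← partialDeriv_trig, h _ (isSmooth_trig _), neg_neg]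
  have h4 := tendsto_nhds_unique h1 (h2.congr h3)
  rw [inner_toLp_left, inner_toLp_left] at h4
  rwa [integral_mul_congr .rfl hvw, integral_mul_congr .rfl hGi] at h4

theorem MemH2.integral_laplacian_mul {u w : Torus → ℝ} (hu : MemH2 u) (hw : MemH2 w) :
    ∫ p, laplacian u p * w p = - ∫ p, ∑ i, weakPartial i u p * weakPartial i w p := by
  simp only [laplacian, Finset.sum_mul]
  rw [integral_finsetSum _ fun i _ => integrable_mul_of_memLp ((hu.2 i).2 i).memLp hw.memLp,
    integral_finsetSum _ fun i _ =>
      integrable_mul_of_memLp (hu.memLp_weakPartial i) (hw.memLp_weakPartial i),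
    ← Finset.sum_neg_distrib]
  exact Finset.sum_congr rfl fun i _ => hw.integral_mul ((hu.2 i).2 i).isWeakPartial
    (hu.memLp_weakPartial i) ((hu.2 i).2 i).memLp

/-! ### Existence by monotone iteration -/

/-- The right-hand side `uₙ / k + (2 v - f(v)) / ε²` of the monotone iteration. -/
def iterRhs (ε k : ℝ) (un v : Torus → ℝ) (p : Torus) : ℝ := un p / k + (3 * v p - v p ^ 3) / ε ^ 2

/-- The shift `1 / k + 2 / ε²` that makes the iteration monotone. -/
def iterShift (ε k : ℝ) : ℝ := 1 / k + 2 / ε ^ 2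

theorem iterShift_pos {ε k : ℝ} (hε : 0 < ε) (hk : 0 < k) : 0 < iterShift ε k := by
  unfold iterShift; positivity

/-- The difference factors as `(t - s)(3 - s² - st - t²)`, with second factor nonnegative on
`[-1,1]`. This dictates the shift by `2 = f_∞`. -/
theorem cubic_mono {s t : ℝ} (hs : s ∈ Set.Icc (-1 : ℝ) 1) (ht : t ∈ Set.Icc (-1 : ℝ) 1)
    (h : s ≤ t) : 3 * s - s ^ 3 ≤ 3 * t - t ^ 3 := by
  have h1 : s ^ 2 ≤ 1 := by nlinarith [hs.1, hs.2]
  have h2 : t ^ 2 ≤ 1 := by nlinarith [ht.1, ht.2]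
  have h3 : 0 ≤ 3 - s ^ 2 - s * t - t ^ 2 := by nlinarith [sq_nonneg (s - t)]
  nlinarith [mul_nonneg (sub_nonneg.2 h) h3]

theorem cubic_mem {s : ℝ} (hs : s ∈ Set.Icc (-1 : ℝ) 1) :
    3 * s - s ^ 3 ∈ Set.Icc (-2 : ℝ) 2 := by
  have h1 := cubic_mono hs (Set.right_mem_Icc.2 (by norm_num)) hs.2
  have h2 := cubic_mono (Set.left_mem_Icc.2 (by norm_num)) hs hs.1
  norm_num at h1 h2
  exact ⟨by linarith, by linarith⟩

/-- These bounds make the constants `-1` and `1` a lower and an upper barrier for each linear step.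
-/
theorem iterRhs_mem {ε k : ℝ} (hk : 0 < k) {un v : Torus → ℝ} {p : Torus}
    (hun : un p ∈ Set.Icc (-1 : ℝ) 1) (hv : v p ∈ Set.Icc (-1 : ℝ) 1) :
    iterRhs ε k un v p ∈ Set.Icc (iterShift ε k * (-1)) (iterShift ε k * 1) := by
  have h := cubic_mem hv
  have h1 := div_le_div_of_nonneg_right hun.1 hk.le
  have h2 := div_le_div_of_nonneg_right hun.2 hk.le
  have h3 := div_le_div_of_nonneg_right h.1 (sq_nonneg ε)
  have h4 := div_le_div_of_nonneg_right h.2 (sq_nonneg ε)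
  rw [neg_div] at h1 h3
  unfold iterRhs iterShift
  constructor <;> linarith

theorem iterRhs_mono {ε k : ℝ} {un v w : Torus → ℝ} {p : Torus}
    (hv : v p ∈ Set.Icc (-1 : ℝ) 1) (hw : w p ∈ Set.Icc (-1 : ℝ) 1) (h : v p ≤ w p) :
    iterRhs ε k un v p ≤ iterRhs ε k un w p := by
  have := div_le_div_of_nonneg_right (cubic_mono hv hw h) (sq_nonneg ε)
  unfold iterRhs
  linarith

theorem memLp_of_ae_mem_Icc {v : Torus → ℝ} (hv : AEStronglyMeasurable v volume) {a : ℝ}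
    (h : ∀ᵐ p, v p ∈ Set.Icc (-a) a) : MemLp v 2 volume :=
  MemLp.of_bound hv a (h.mono fun _ hp => abs_le.2 hp)

theorem memLp_iterRhs {ε k : ℝ} (hk : 0 < k) {un v : Torus → ℝ}
    (hun : MemLp un 2 volume) (hun' : ValuesInUnit un) (hv : MemLp v 2 volume)
    (hv' : ValuesInUnit v) : MemLp (iterRhs ε k un v) 2 volume := by
  refine memLp_of_ae_mem_Icc (a := iterShift ε k) ?_ ?_
  · have h1 := hun.1
    have h2 := hv.1
    unfold iterRhs
    fun_prop
  · filter_upwards [hun', hv'] with p h1 h2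
    simpa using iterRhs_mem hk h1 h2

theorem exists_iter_step {ε k : ℝ} (hε : 0 < ε) (hk : 0 < k) {un v : Torus → ℝ}
    (hun : MemLp un 2 volume) (hun' : ValuesInUnit un) (hv : MemLp v 2 volume)
    (hv' : ValuesInUnit v) :
    ∃ w, MemH2 w ∧ ValuesInUnit w ∧
      ∀ᵐ p, iterShift ε k * w p - laplacian w p = iterRhs ε k un v p := by
  have hl := iterShift_pos hε hk
  have hr := memLp_iterRhs (ε := ε) hk hun hun' hv hv'
  obtain ⟨w, -, -, hw, hsol, -, -⟩ := exists_memH2_approx hl hr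
  have hvw := hw.isVeryWeak hsol
  have h1 := hvw.ae_le hl hw.memLp (memLp_const 1) hr (memLp_const _)
    (isVeryWeak_const _ 1) (by
      filter_upwards [hun', hv'] with p h1 h2 using (iterRhs_mem hk h1 h2).2)
  have h2 := (isVeryWeak_const _ (-1)).ae_le hl (memLp_const (-1)) hw.memLp (memLp_const _) hr
    hvw (by filter_upwards [hun', hv'] with p h1 h2 using (iterRhs_mem hk h1 h2).1)
  refine ⟨w, hw, ?_, hsol⟩
  filter_upwards [h1, h2] with p h3 h4 using ⟨h4, h3⟩

theorem exists_iteration {ε k : ℝ} (hε : 0 < ε) (hk : 0 < k) {un : Torus → ℝ}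
    (hun : MemLp un 2 volume) (hun' : ValuesInUnit un) :
    ∃ u : ℕ → Torus → ℝ, (∀ m, MemLp (u m) 2 volume) ∧ (∀ m, ValuesInUnit (u m)) ∧
      (∀ m, IsVeryWeak (iterShift ε k) (u (m + 1)) (iterRhs ε k un (u m))) ∧
      ∀ m, u (m + 1) ≤ᵐ[volume] u m := by
  have hl := iterShift_pos hε hk
  choose S hS using fun v : {v : Torus → ℝ // MemLp v 2 volume ∧ ValuesInUnit v} =>
    exists_iter_step hε hk hun hun' v.2.1 v.2.2
  let u : ℕ → {v : Torus → ℝ // MemLp v 2 volume ∧ ValuesInUnit v} := fun m =>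
    -- Starting at the upper barrier makes the first decrease automatic; comparison propagates it.
    m.rec ⟨fun _ => 1, memLp_const 1, .of_forall fun _ => by norm_num⟩
      fun _ v => ⟨S v, (hS v).1.memLp, (hS v).2.1⟩
  have hvw : ∀ m, IsVeryWeak (iterShift ε k) (u (m + 1)).1 (iterRhs ε k un (u m).1) := fun m =>
    (hS (u m)).1.isVeryWeak (hS (u m)).2.2
  have hr := fun m => memLp_iterRhs (ε := ε) hk hun hun' (u m).2.1 (u m).2.2
  refine ⟨fun m => (u m).1, fun m => (u m).2.1, fun m => (u m).2.2, hvw, fun m => ?_⟩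
  induction m with
  | zero => exact (u 1).2.2.mono fun p hp => hp.2
  | succ m ih =>
    refine (hvw (m + 1)).ae_le hl (u (m + 2)).2.1 (u (m + 1)).2.1 (hr (m + 1)) (hr m) (hvw m) ?_
    filter_upwards [ih, (u m).2.2, (u (m + 1)).2.2] with p h1 h2 h3
    exact iterRhs_mono h3 h2 h1

theorem exists_solvesBE {ε k : ℝ} (hε : 0 < ε) (hk : 0 < k) {un : Torus → ℝ}
    (hun : MemLp un 2 volume) (hun' : ValuesInUnit un) :
    ∃ u, MemH2 u ∧ SolvesBE ε k un u ∧ ValuesInUnit u := by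
  have hl := iterShift_pos hε hk
  obtain ⟨u, hmem, hval, hvw, hanti⟩ := exists_iteration hε hk hun hun'
  let U : Torus → ℝ := fun p => ⨅ m, u m p
  have hlim : ∀ᵐ p, Tendsto (fun m => u m p) atTop (𝓝 (U p)) := by
    filter_upwards [ae_all_iff.2 hval, ae_all_iff.2 hanti] with p h1 h2
    refine tendsto_atTop_ciInf (antitone_nat_of_succ_le h2) ⟨-1, ?_⟩
    rintro _ ⟨m, rfl⟩
    exact (h1 m).1
  have hUval : ValuesInUnit U := by
    filter_upwards [ae_all_iff.2 hval, hlim] with p h1 h2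
    exact isClosed_Icc.mem_of_tendsto h2 (.of_forall h1)
  have hUmem : MemLp U 2 volume := memLp_of_ae_mem_Icc
    (aestronglyMeasurable_of_tendsto_ae _ (fun m => (hmem m).1) hlim) hUval
  have hr := fun m => memLp_iterRhs (ε := ε) hk hun hun' (hmem m) (hval m)
  have hrU := memLp_iterRhs (ε := ε) hk hun hun' hUmem hUval
  have hUvw : IsVeryWeak (iterShift ε k) U (iterRhs ε k un U) := by
    intro c
    have hi := fun c => integrable_of_continuous (map_continuous (trig c))
    have t1 : Tendsto (fun m => ∫ p, u m p * trig (helm (iterShift ε k) • c) p) atTop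
        (𝓝 (∫ p, U p * trig (helm (iterShift ε k) • c) p)) := by
      refine tendsto_integral_of_dominated_convergence
        (fun p => |trig (helm (iterShift ε k) • c) p|)
        (fun m => ((hmem m).1.mul (hi _).1)) (hi _).abs (fun m => ?_) ?_
      · filter_upwards [hval m] with p hp
        rw [Real.norm_eq_abs, abs_mul]
        exact mul_le_of_le_one_left (abs_nonneg _) (abs_le.2 hp)
      · filter_upwards [hlim] with p hp using hp.mul_const _
    have t2 : Tendsto (fun m => ∫ p, iterRhs ε k un (u m) p * trig c p) atTop
        (𝓝 (∫ p, iterRhs ε k un U p * trig c p)) := by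
      refine tendsto_integral_of_dominated_convergence
        (fun p => iterShift ε k * |trig c p|)
        (fun m => ((hr m).1.mul (hi _).1)) ((hi _).abs.const_mul _) (fun m => ?_) ?_
      · filter_upwards [hval m, hun'] with p h1 h2
        rw [Real.norm_eq_abs, abs_mul]
        refine mul_le_mul_of_nonneg_right (abs_le.2 ?_) (abs_nonneg _)
        simpa using iterRhs_mem hk h2 h1
      · filter_upwards [hlim] with p hp
        exact ((((hp.const_mul 3).sub (hp.pow 3)).div_const _).const_add _).mul_const _
    -- The iterate on the left is one step ahead of the one on the right; both have limit `U`.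
    exact tendsto_nhds_unique ((tendsto_add_atTop_iff_nat 1).2 t1)
      (t2.congr fun m => (hvw m c).symm)
  -- `U` is only known to be in `L²`; regularity comes from solving the linear problem with its
  -- right side and identifying the two.
  obtain ⟨w, -, -, hw, hsol, -, -⟩ := exists_memH2_approx hl hrU
  have hwU := (hw.isVeryWeak hsol).ae_eq hl hw.memLp hUmem hrU hUvw
  refine ⟨w, hw, ?_, ?_⟩
  · filter_upwards [hwU, hsol] with p h1 h2
    rw [iterRhs, iterShift, ← h1] at h2
    have h3 : laplacian w p = (1 / k + 2 / ε ^ 2) * (w : Torus → ℝ) p -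
      (un p / k + (3 * w p - w p ^ 3) / ε ^ 2) := by linarith
    rw [h3, f]
    field_simp
    ring
  · filter_upwards [hwU, hUval] with p h1 h2
    rwa [h1]

/-! ### Uniqueness and energy decay -/

/-- On `[-1,1]`, `f' = 3s² - 1` ranges over `[-1,2]`, with the maximum modulus at the endpoints. -/
theorem fInf_eq : fInf = 2 := by
  have hd : ∀ s, deriv f s = 3 * s ^ 2 - 1 := fun s => by
    have h : HasDerivAt f (3 * s ^ 2 - 1) s := by
      simpa using! (hasDerivAt_pow 3 s).sub (hasDerivAt_id s)
    exact h.deriv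
  refine IsGreatest.csSup_eq ⟨⟨1, by norm_num, by simp only [hd]; norm_num⟩, ?_⟩
  rintro _ ⟨s, hs, rfl⟩
  simp only [hd]
  rw [abs_le]
  constructor <;> nlinarith [hs.1, hs.2, sq_nonneg s]

theorem integral_sub_sub_sub {a b c d : Torus → ℝ} (ha : Integrable a volume)
    (hb : Integrable b volume) (hc : Integrable c volume) (hd : Integrable d volume) :
    ∫ p, ((a p - b p) - (c p - d p)) =
      ((∫ p, a p) - ∫ p, b p) - ((∫ p, c p) - ∫ p, d p) := by
  rw [← integral_sub ha hb, ← integral_sub hc hd]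
  exact integral_sub (ha.sub hb) (hc.sub hd)

theorem SolvesBE.laplacian_eq {ε k : ℝ} (hk : 0 < k) {un u : Torus → ℝ} (h : SolvesBE ε k un u) :
    ∀ᵐ p, laplacian u p = (u p - un p) / k + f (u p) / ε ^ 2 := by
  filter_upwards [h] with p hp
  rw [← hp]
  field_simp
  ring

/-- Integration by parts gives `∫ (Δv - Δu)(v - u) ≤ 0`, while the equation makes the integrand
nonnegative. No bound on `u` or `v` is needed, because the cubic is monotone on all of `ℝ`. -/
theorem SolvesBE.ae_eq {ε k : ℝ} (hε : 0 < ε) (hk : 0 < k) (hkε : k ≤ ε ^ 2) {un u v : Torus → ℝ}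
    (hu : MemH2 u) (hv : MemH2 v) (h : SolvesBE ε k un u) (h' : SolvesBE ε k un v) :
    v =ᵐ[volume] u := by
  let q : Torus → ℝ := fun p => (laplacian v p - laplacian u p) * (v p - u p)
  have hq : ∀ᵐ p, q p = (1 / k - 1 / ε ^ 2) * (v p - u p) ^ 2 +
      (v p ^ 2 + v p * u p + u p ^ 2) * (v p - u p) ^ 2 / ε ^ 2 := by
    filter_upwards [h.laplacian_eq hk, h'.laplacian_eq hk] with p h1 h2
    simp only [q, h1, h2, f]
    ring
  have hk' : 0 ≤ 1 / k - 1 / ε ^ 2 := sub_nonneg.2 (one_div_le_one_div_of_le hk hkε)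
  have hpos : ∀ s t : ℝ, 0 ≤ s ^ 2 + s * t + t ^ 2 := fun s t => by
    nlinarith [sq_nonneg (s + t), sq_nonneg s, sq_nonneg t]
  have hq0 : 0 ≤ᵐ[volume] q := by
    filter_upwards [hq] with p hp
    rw [hp]
    have := hpos (v p) (u p)
    positivity
  have hint : Integrable q volume :=
    integrable_mul_of_memLp (hv.memLp_laplacian.sub hu.memLp_laplacian) (hv.memLp.sub hu.memLp)
  have hle : ∫ p, q p ≤ 0 := by
    have hi : ∀ {a b : Torus → ℝ}, MemH2 a → MemH2 b →
        Integrable (fun p => laplacian a p * b p) volume :=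
      fun ha hb => integrable_mul_of_memLp ha.memLp_laplacian hb.memLp
    have hg : ∀ {a b : Torus → ℝ}, MemH2 a → MemH2 b →
        Integrable (fun p => ∑ i, weakPartial i a p * weakPartial i b p) volume :=
      fun ha hb => integrable_finsetSum _ fun i _ =>
        integrable_mul_of_memLp (ha.memLp_weakPartial i) (hb.memLp_weakPartial i)
    have e1 : ∫ p, q p = ((∫ p, laplacian v p * v p) - ∫ p, laplacian v p * u p) -
        ((∫ p, laplacian u p * v p) - ∫ p, laplacian u p * u p) := by
      rw [← integral_sub_sub_sub (hi hv hv) (hi hv hu) (hi hu hv) (hi hu hu)]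
      exact integral_congr_ae (.of_forall fun p => by simp only [q]; ring)
    have e2 : ∫ p, ∑ i, (weakPartial i v p - weakPartial i u p) ^ 2 =
        ((∫ p, ∑ i, weakPartial i v p * weakPartial i v p) -
          ∫ p, ∑ i, weakPartial i v p * weakPartial i u p) -
        ((∫ p, ∑ i, weakPartial i u p * weakPartial i v p) -
          ∫ p, ∑ i, weakPartial i u p * weakPartial i u p) := by
      rw [← integral_sub_sub_sub (hg hv hv) (hg hv hu) (hg hu hv) (hg hu hu)]
      exact integral_congr_ae (.of_forall fun p => by simp only [Fin.sum_univ_two]; ring)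
    have e3 : 0 ≤ ∫ p, ∑ i, (weakPartial i v p - weakPartial i u p) ^ 2 :=
      integral_nonneg fun p => Finset.sum_nonneg fun i _ => sq_nonneg _
    rw [e1, hv.integral_laplacian_mul hv, hv.integral_laplacian_mul hu,
      hu.integral_laplacian_mul hv, hu.integral_laplacian_mul hu]
    linarith
  have hz := (integral_eq_zero_iff_of_nonneg_ae hq0 hint).1
    (le_antisymm hle (integral_nonneg_of_ae hq0))
  filter_upwards [hz, hq] with p h1 h2
  rw [h2] at h1
  by_contra hne
  have h3 : 0 < (v p - u p) ^ 2 := by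
    have := sub_ne_zero.2 hne
    positivity
  -- Strictness comes from the cubic term, which covers the borderline case `k = ε²`.
  have h4 : 0 < v p ^ 2 + v p * u p + u p ^ 2 := by
    nlinarith [sq_nonneg (v p + u p)]
  have h5 : 0 < (v p ^ 2 + v p * u p + u p ^ 2) * (v p - u p) ^ 2 / ε ^ 2 := by positivity
  have h6 := mul_nonneg hk' h3.le
  simp only [Pi.zero_apply] at h1
  linarith

/-- Taylor's formula at `s` with `W'' ≥ -1`; the remainder is an explicit product of squares, so no
range restriction is needed. -/
theorem W_sub_le (s t : ℝ) : W s - W t ≤ f s * (s - t) + (s - t) ^ 2 / 2 := by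
  have h : f s * (s - t) + (s - t) ^ 2 / 2 - (W s - W t) =
      (s - t) ^ 2 * ((t + s) ^ 2 + 2 * s ^ 2) / 4 := by
    unfold f W; ring
  have : 0 ≤ (s - t) ^ 2 * ((t + s) ^ 2 + 2 * s ^ 2) / 4 := by positivity
  linarith

theorem integrable_energy (ε : ℝ) {u : Torus → ℝ} (hu : MemH2 u) (hu' : ValuesInUnit u) :
    Integrable (fun p => (∑ i, weakPartial i u p ^ 2) / 2 + W (u p) / ε ^ 2) volume := by
  refine Integrable.add ?_ ?_
  · refine (integrable_finsetSum _ fun i _ => ?_).div_const 2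
    simpa only [sq] using integrable_mul_of_memLp (hu.memLp_weakPartial i) (hu.memLp_weakPartial i)
  · refine Integrable.div_const ?_ _
    refine Integrable.of_bound (C := 1) ?_ ?_
    · have := hu.memLp.1
      unfold W
      fun_prop
    · filter_upwards [hu'] with p hp
      have h1 : u p ^ 2 ≤ 1 := by nlinarith [hp.1, hp.2]
      rw [Real.norm_eq_abs, W, abs_le]
      constructor <;> nlinarith [sq_nonneg (u p), sq_nonneg (u p ^ 2 - 1)]

theorem energy_le {ε k : ℝ} (hε : 0 < ε) (hk : 0 < k) (hkε : k ≤ ε ^ 2) {un u : Torus → ℝ}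
    (hun : MemH2 un) (hun' : ValuesInUnit un) (hu : MemH2 u) (hu' : ValuesInUnit u)
    (h : SolvesBE ε k un u) : energy ε u ≤ energy ε un := by
  have i1 := integrable_energy ε hu hu'
  have i2 := integrable_energy ε hun hun'
  have hi : ∀ {b : Torus → ℝ}, MemH2 b → Integrable (fun p => laplacian u p * b p) volume :=
    fun hb => integrable_mul_of_memLp hu.memLp_laplacian hb.memLp
  have hg : ∀ {b : Torus → ℝ}, MemH2 b →
      Integrable (fun p => ∑ i, weakPartial i u p * weakPartial i b p) volume :=
    fun hb => integrable_finsetSum _ fun i _ =>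
      integrable_mul_of_memLp (hu.memLp_weakPartial i) (hb.memLp_weakPartial i)
  -- Inserting this vanishing integral reduces the energy inequality to a pointwise one, where
  -- `|a|²/2 - |b|²/2 ≤ a·(a - b)` handles the gradients.
  have hibp : ∫ p, (((∑ i, weakPartial i u p * weakPartial i u p) -
      ∑ i, weakPartial i u p * weakPartial i un p) -
      (laplacian u p * un p - laplacian u p * u p)) = 0 := by
    rw [integral_sub_sub_sub (hg hu) (hg hun) (hi hun) (hi hu),
      hu.integral_laplacian_mul hu, hu.integral_laplacian_mul hun]
    ring
  rw [← sub_nonpos, energy, energy, ← integral_sub i1 i2, ← hibp]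
  refine integral_mono_ae (i1.sub i2) (((hg hu).sub (hg hun)).sub ((hi hun).sub (hi hu))) ?_
  filter_upwards [h.laplacian_eq hk] with p hp
  have hW := div_le_div_of_nonneg_right (W_sub_le (u p) (un p)) (sq_nonneg ε)
  have hk' : 1 / ε ^ 2 ≤ 1 / k := one_div_le_one_div_of_le hk hkε
  have hs := mul_le_mul_of_nonneg_right hk' (sq_nonneg (u p - un p))
  have hs' : 0 ≤ 1 / ε ^ 2 * (u p - un p) ^ 2 := by positivity
  have h0 := sq_nonneg (weakPartial 0 u p - weakPartial 0 un p)
  have h1 := sq_nonneg (weakPartial 1 u p - weakPartial 1 un p)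
  have e1 : laplacian u p * un p - laplacian u p * u p =
      -(1 / k * (u p - un p) ^ 2) - f (u p) * (u p - un p) / ε ^ 2 := by
    rw [hp]; ring
  have e2 : (f (u p) * (u p - un p) + (u p - un p) ^ 2 / 2) / ε ^ 2 =
      f (u p) * (u p - un p) / ε ^ 2 + 1 / ε ^ 2 * (u p - un p) ^ 2 / 2 := by ring
  rw [e2, sub_div] at hW
  simp only [Fin.sum_univ_two]
  rw [e1]
  linarith

end
end AllenCahn

theorem mainTheorem1 (ε k : ℝ) (hε : 0 < ε) (hk : 0 < k)
    (un : AllenCahn.Torus → ℝ) (hun : AllenCahn.MemH2 un)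
    (hun_range : AllenCahn.ValuesInUnit un) :
    ∃ u : AllenCahn.Torus → ℝ,
      AllenCahn.MemH2 u ∧ AllenCahn.SolvesBE ε k un u ∧ AllenCahn.ValuesInUnit u ∧
      (k ≤ 2 * ε ^ 2 / AllenCahn.fInf →
        (∀ v : AllenCahn.Torus → ℝ, AllenCahn.MemH2 v → AllenCahn.SolvesBE ε k un v →
          v =ᵐ[MeasureTheory.volume] u) ∧
        AllenCahn.energy ε u ≤ AllenCahn.energy ε un) := by
  obtain ⟨u, hu, hsol, hval⟩ := AllenCahn.exists_solvesBE hε hk hun.memLp hun_range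
  refine ⟨u, hu, hsol, hval, fun hkε => ?_⟩
  rw [AllenCahn.fInf_eq, mul_div_cancel_left₀ _ two_ne_zero] at hkε
  exact ⟨fun v hv hv' => hsol.ae_eq hε hk hkε hu hv hv',
    AllenCahn.energy_le hε hk hkε hun hun_range hu hval hsol⟩
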